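/- All graphs are finite, simple and undirected. For a graph $G$ let $\omega(G)$ be its clique number and $\mathrm{tw}(G)$ its treewidth (with value $0$ for the graph with no vertices). A graph $H$ is an induced minor of $G$ if it can be obtained from $G$ by a sequence of vertex deletions and edge contractions; equivalently, there are pairwise disjoint nonempty sets $X_u \subseteq V(G)$, $u\in V(H)$, each inducing a connected subgraph of $G$, such that for all distinct $u,v\in V(H)$ there is an edge of $G$ between $X_u$ and $X_v$ if and only if $uv\in E(H)$. A graph is $H$-induced-minor-free if $H$ is not an induced minor of it. A function $f:\mathbb{N}\to\mathbb{N}$ is a $(\mathrm{tw},\omega)$-binding function for a class $\mathcal{G}$ of graphs if $\mathrm{tw}(G')\le f(\omega(G'))$ for every $G\in\mathcal{G}$ and every induced subgraph $G'$ of $G$; the class is $(\mathrm{tw},\omega)$-bounded if it has such a function. Let $R(k,\ell)$ be the least positive integer such that every graph with at least $R(k,\ell)$ vertices contains a clique of size $k$ or an independent set of size $\ell$. **Lemma.** For every $q\in\mathbb{N}=\{0,1,2,\dots\}$, the class of $K_{2,q}$-induced-minor-free graphs is $(\mathrm{tw},\omega)$-bounded, with binding function $$f(k)=\max\{k,\;2R(k+1,q)-2\}-1,$$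 where, for $k=0$ (the graph with no vertices), a value $-1$ of the right-hand side is read as $0$. -/

import Mathlib

universe u v w

namespace TwOmega

/-- A tree decomposition of a graph `G`: a finite tree together with a bag (a set of vertices
of `G`) at each node of the tree.  Trees on all finite types in `Type` suffice, since every finite
tree is isomorphic to one of these. -/
structure TreeDecomposition {V : Type u} (G : SimpleGraph V) where
  /-- the nodes of the tree -/
  Node : Type
  finite_node : Finite Node
  /-- the tree -/
  tree : SimpleGraph Node
  isTree : tree.IsTree
  /-- the bags -/
  bag : Node → Set V
  /-- the bags cover the vertex set -/
  iUnion_bag : ⋃ t, bag t = Set.univ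
  /-- every edge is contained in a bag -/
  exists_bag_of_adj : ∀ a b : V, G.Adj a b → ∃ t, a ∈ bag t ∧ b ∈ bag t
  /-- the nodes whose bags contain a given vertex induce a connected subtree -/
  connected_nodes : ∀ a : V, (tree.induce {t | a ∈ bag t}).Connected

/-- The width of a tree decomposition: the maximum size of a bag, minus one.  The subtraction
truncates only if all bags are empty, that is, if the graph has no vertices. -/
noncomputable def TreeDecomposition.width {V : Type u} {G : SimpleGraph V}
    (D : TreeDecomposition G) : ℕ :=
  (⨆ t : D.Node, (D.bag t).ncard) - 1

/-- The treewidth of a (finite) graph: the minimum width of a tree decomposition. The graph with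
no vertices has treewidth `0` here. -/
noncomputable def treewidth {V : Type u} (G : SimpleGraph V) : ℕ :=
  sInf {n : ℕ | ∃ D : TreeDecomposition G, D.width = n}

/-- An induced minor model of `H` in `G`: pairwise disjoint connected (in particular nonempty)
bags in `G`, indexed by the vertices of `H`, such that there is an edge of `G` between two distinct
bags if and only if the two vertices of `H` are adjacent. -/
structure InducedMinorModel {W : Type w} {V : Type v} (H : SimpleGraph W) (G : SimpleGraph V) where
  /-- the bags -/
  bag : W → Set V
  disjoint_bag : ∀ a b : W, a ≠ b → Disjoint (bag a) (bag b)
  connected_bag : ∀ a : W, (G.induce (bag a)).Connected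
  adj_iff : ∀ a b : W, a ≠ b → ((∃ x ∈ bag a, ∃ y ∈ bag b, G.Adj x y) ↔ H.Adj a b)

/-- `H` is an induced minor of `G`. -/
def IsInducedMinor {W : Type w} {V : Type v} (H : SimpleGraph W) (G : SimpleGraph V) : Prop :=
  Nonempty (InducedMinorModel H G)

/-- The Ramsey number `R(k, l)`: the least positive integer `N` such that every finite graph with
at least `N` vertices has a clique of size `k` or an independent set of size `l`. -/
noncomputable def ramseyNumber (k l : ℕ) : ℕ :=
  sInf {N : ℕ | 0 < N ∧ ∀ n : ℕ, N ≤ n → ∀ G : SimpleGraph (Fin n),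
    (∃ s : Finset (Fin n), G.IsNClique k s) ∨ (∃ s : Finset (Fin n), G.IsNIndepSet l s)}

/-- A class of graphs; only its finite members are considered below. -/
def GraphClass : Type (u + 1) := ∀ V : Type u, SimpleGraph V → Prop

/-- `f` is a `(tw, ω)`-binding function for the class `𝒢` of finite graphs: every induced subgraph
`G'` of every member of `𝒢` satisfies `tw(G') ≤ f(ω(G'))`. -/
def IsTwOmegaBindingFunction (𝒢 : GraphClass.{u}) (f : ℕ → ℕ) : Prop :=
  ∀ (V : Type u) [Finite V] (G : SimpleGraph V), 𝒢 V G →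
    ∀ S : Set V, treewidth (G.induce S) ≤ f (G.induce S).cliqueNum

/-- A class of graphs is `(tw, ω)`-bounded if it has a `(tw, ω)`-binding function. -/
def IsTwOmegaBounded (𝒢 : GraphClass.{u}) : Prop :=
  ∃ f : ℕ → ℕ, IsTwOmegaBindingFunction 𝒢 f

/-- The class of `H`-induced-minor-free graphs. -/
def inducedMinorFree {W : Type w} (H : SimpleGraph W) : GraphClass.{u} :=
  fun _ G => ¬ IsInducedMinor H G

end TwOmega

/-!
Let `A` and `B` be anticomplete connected vertex sets of `G`. If `q` of their common neighbours are
independent, then these together with `A` and `B` form a model of `K_{2,q}`; hence, in a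
`K_{2,q}`-induced-minor-free graph, Ramsey's theorem leaves room for at most `s = R(ω + 1, q) - 1`
common neighbours.

Under such a bound, every `G[U]` has a tree decomposition with bags of size at most `max ω (2s)`.
By induction on `U`, we ask moreover that the neighbourhood `N_U(A)` of any connected set `A`
outside `U` with at most `s` neighbours in `U` lies in a single bag. A clique lies in a bag of
every tree decomposition, so if `N_U(A)` is a clique we may replace `A` by `∅`. Unless `U` itself
is a clique, there are then nonadjacent vertices `x` and `y` of `U` such that `A ∪ {x}` and
`A ∪ {y}` are connected. Let `Y` be the component of `y` in `G[U] - N[x]` and take as root bag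
`Ω = N_U(A) ∪ (N_U(x) ∩ N_U(Y))`, of size at most `2s`. Each component `D` of `G[U] - Ω` is
anticomplete to `x` or to `Y`, so all of `Ω` lies in the neighbourhood of a connected set (`A ∪ {x}`
or `A ∪ Y`) that is anticomplete to `D`. Thus `D` has at most `s` neighbours in `Ω`, and the
induction hypothesis for `D ∪ N_Ω(D)` allows it to be attached to `Ω`.
-/

namespace TwOmega

open SimpleGraph

section Sets

variable {V : Type u} {W : Type v} {G : SimpleGraph V} {H : SimpleGraph W}

/-- The vertices with a neighbour in `A`. Vertices of `A` itself are not excluded. -/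
def nbhd (G : SimpleGraph V) (A : Set V) : Set V :=
  {v | ∃ a ∈ A, G.Adj a v}

/-- Two vertex sets are anticomplete if they are disjoint and no edge joins them. -/
def Anticomplete (G : SimpleGraph V) (A B : Set V) : Prop :=
  ∀ ⦃a⦄, a ∈ A → ∀ ⦃b⦄, b ∈ B → a ≠ b ∧ ¬ G.Adj a b

lemma nbhd_union (A B : Set V) : nbhd G (A ∪ B) = nbhd G A ∪ nbhd G B := by
  ext v
  simp only [nbhd, Set.mem_ofPred_eq, Set.mem_union, or_and_right, exists_or]

lemma Anticomplete.symm {A B : Set V} (h : Anticomplete G A B) : Anticomplete G B A :=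
  fun _ hb _ ha => ⟨(h ha hb).1.symm, fun hba => (h ha hb).2 hba.symm⟩

lemma Anticomplete.disjoint {A B : Set V} (h : Anticomplete G A B) : Disjoint A B :=
  Set.disjoint_left.2 fun _ ha hb => (h ha hb).1 rfl

lemma Anticomplete.disjoint_nbhd {A B : Set V} (h : Anticomplete G A B) :
    Disjoint A (nbhd G B) :=
  Set.disjoint_left.2 fun _ ha ⟨_, hb, hba⟩ => (h ha hb).2 hba.symm

lemma Anticomplete.union_left {A B C : Set V} (hA : Anticomplete G A C)
    (hB : Anticomplete G B C) : Anticomplete G (A ∪ B) C :=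
  fun _ hab _ hc => hab.elim (fun ha => hA ha hc) fun hb => hB hb hc

lemma anticomplete_of_disjoint {A B : Set V} (h : Disjoint A B) (hn : Disjoint B (nbhd G A)) :
    Anticomplete G A B :=
  fun a ha _ hb => ⟨h.ne_of_mem ha hb, fun hab => Set.disjoint_left.1 hn hb ⟨a, ha, hab⟩⟩

lemma exists_not_adj_of_not_isClique {S : Set V} (h : ¬ G.IsClique S) :
    ∃ x ∈ S, ∃ y ∈ S, x ≠ y ∧ ¬ G.Adj x y := by
  by_contra! hS
  exact h fun x hx y hy hxy => hS x hx y hy hxy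

lemma connected_induce_singleton (x : V) : (G.induce {x}).Connected :=
  .of_subsingleton

lemma connected_induce_image (f : G →g H) {S : Set V} (h : (G.induce S).Connected) :
    (H.induce (f '' S)).Connected :=
  h.map (induceHom f (Set.mapsTo_image f S)) (Set.surjective_mapsTo_image_restrict f S)

lemma subset_of_preconnected_of_adj_mem {D X : Set V} (hD : (G.induce D).Preconnected)
    (hne : (D ∩ X).Nonempty) (hX : ∀ a ∈ X, ∀ b ∈ D, G.Adj a b → b ∈ X) : D ⊆ X := by
  obtain ⟨a, haD, haX⟩ := hne
  by_contra hDX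
  obtain ⟨b, hbD, hbX⟩ := Set.not_subset.1 hDX
  obtain ⟨p⟩ := hD ⟨a, haD⟩ ⟨b, hbD⟩
  obtain ⟨d, -, hfst, hsnd⟩ := p.exists_boundary_dart (Subtype.val ⁻¹' X) haX hbX
  exact hsnd (hX _ hfst _ d.snd.2 d.adj)

lemma anticomplete_or_anticomplete {D X Y : Set V} (hD : (G.induce D).Preconnected)
    (hXY : Anticomplete G X Y) (hDY : D ∩ nbhd G Y ⊆ Y) :
    Anticomplete G X D ∨ Anticomplete G Y D := by
  by_cases hne : (D ∩ Y).Nonempty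
  · have hsub : D ⊆ Y :=
      subset_of_preconnected_of_adj_mem hD hne fun a ha _ hb hab => hDY ⟨hb, a, ha, hab⟩
    exact .inl fun _ hx _ hd => hXY hx (hsub hd)
  · have hdis : Disjoint Y D :=
      (Set.disjoint_iff_inter_eq_empty.2 (Set.not_nonempty_iff_eq_empty.1 hne)).symm
    exact .inr (anticomplete_of_disjoint hdis
      (Set.disjoint_left.2 fun _ hd hdY => hdis.notMem_of_mem_left (hDY ⟨hd, hdY⟩) hd))

end Sets

section Components

variable {V : Type u} {G : SimpleGraph V} {W : Set V}

/-- The vertex set of a connected component of `G[W]`, as a set of vertices of `G`. -/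
def componentSet (c : (G.induce W).ConnectedComponent) : Set V :=
  (↑) '' c.supp

lemma componentSet_subset (c : (G.induce W).ConnectedComponent) : componentSet c ⊆ W :=
  Subtype.coe_image_subset W c.supp

lemma connected_induce_componentSet (c : (G.induce W).ConnectedComponent) :
    (G.induce (componentSet c)).Connected :=
  connected_induce_image (Embedding.induce W).toHom c.connected_toSimpleGraph

lemma mem_componentSet_of_adj {c : (G.induce W).ConnectedComponent} {a b : V}
    (ha : a ∈ componentSet c) (hb : b ∈ W) (hab : G.Adj a b) : b ∈ componentSet c := by
  obtain ⟨a, ha, rfl⟩ := ha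
  exact ⟨⟨b, hb⟩, (c.mem_supp_congr_adj (by simpa using hab)).1 ha, rfl⟩

lemma pairwise_anticomplete_componentSet :
    Pairwise fun c d : (G.induce W).ConnectedComponent =>
      Anticomplete G (componentSet c) (componentSet d) := by
  intro c d hcd
  have hdis : Disjoint (componentSet c) (componentSet d) :=
    (Set.disjoint_image_iff Subtype.val_injective).2
      (pairwise_disjoint_supp_connectedComponent _ hcd)
  refine anticomplete_of_disjoint hdis (Set.disjoint_left.2 fun b hb ⟨a, ha, hab⟩ => ?_)
  exact hdis.notMem_of_mem_left
    (mem_componentSet_of_adj ha (componentSet_subset d hb) hab) hb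

lemma iUnion_componentSet :
    ⋃ c : (G.induce W).ConnectedComponent, componentSet c = W := by
  refine (Set.iUnion_subset componentSet_subset).antisymm fun w hw => ?_
  exact Set.mem_iUnion.2 ⟨(G.induce W).connectedComponentMk ⟨w, hw⟩, ⟨w, hw⟩, rfl, rfl⟩

lemma exists_connected_anticomplete_singleton {U : Set V} {x y : V} (hy : y ∈ U) (hxy : x ≠ y)
    (hadj : ¬ G.Adj x y) :
    ∃ Y : Set V, y ∈ Y ∧ (G.induce Y).Connected ∧ Anticomplete G {x} Y ∧
      U ∩ nbhd G Y ⊆ Y ∪ nbhd G {x} := by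
  let W : Set V := {z | z ∈ U ∧ x ≠ z ∧ ¬ G.Adj x z}
  let c := (G.induce W).connectedComponentMk ⟨y, hy, hxy, hadj⟩
  have hcW : componentSet c ⊆ W := componentSet_subset c
  refine ⟨componentSet c, ⟨_, rfl, rfl⟩, connected_induce_componentSet c, ?_, ?_⟩
  · rintro _ rfl z hz
    exact (hcW hz).2
  · rintro z ⟨hzU, a, ha, haz⟩
    by_cases hxz : G.Adj x z
    · exact .inr ⟨x, rfl, hxz⟩
    · refine .inl (mem_componentSet_of_adj ha ⟨hzU, ?_, hxz⟩ haz)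
      rintro rfl
      exact (hcW ha).2.2 haz.symm

end Components

section BagTrees

variable {V : Type u} {G : SimpleGraph V}

/-- `IsBagTree G U F` says that `F` is the set of bags of a tree decomposition of `G[U]` that is
built from one-bag decompositions by repeatedly adding an edge between two trees. -/
inductive IsBagTree (G : SimpleGraph V) : Set V → Set (Set V) → Prop
  | single (b : Set V) : IsBagTree G b {b}
  | glue {U₁ U₂ : Set V} {F₁ F₂ : Set (Set V)} {b₁ b₂ : Set V} :
      IsBagTree G U₁ F₁ → IsBagTree G U₂ F₂ → b₁ ∈ F₁ → b₂ ∈ F₂ →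
      U₁ ∩ U₂ ⊆ b₁ → U₁ ∩ U₂ ⊆ b₂ → Anticomplete G (U₁ \ U₂) (U₂ \ U₁) →
      IsBagTree G (U₁ ∪ U₂) (F₁ ∪ F₂)

lemma IsBagTree.subset {U b : Set V} {F : Set (Set V)} (h : IsBagTree G U F) (hb : b ∈ F) :
    b ⊆ U := by
  induction h with
  | single b' => exact hb.subset
  | glue _ _ _ _ _ _ _ ih₁ ih₂ =>
    exact hb.elim (fun h => (ih₁ h).trans Set.subset_union_left)
      fun h => (ih₂ h).trans Set.subset_union_right

lemma subset_or_subset_of_isClique {K U₁ U₂ : Set V} (hK : G.IsClique K)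
    (hKU : K ⊆ U₁ ∪ U₂) (h : Anticomplete G (U₁ \ U₂) (U₂ \ U₁)) : K ⊆ U₁ ∨ K ⊆ U₂ := by
  by_contra! hne
  obtain ⟨⟨y, hyK, hy₁⟩, x, hxK, hx₂⟩ := hne.imp Set.not_subset.1 Set.not_subset.1
  obtain ⟨hxy, hadj⟩ := h ⟨(hKU hxK).resolve_right hx₂, hx₂⟩ ⟨(hKU hyK).resolve_left hy₁, hy₁⟩
  exact hadj (hK hxK hyK hxy)

lemma IsBagTree.exists_bag_of_isClique {U K : Set V} {F : Set (Set V)} (h : IsBagTree G U F)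
    (hKU : K ⊆ U) (hK : G.IsClique K) : ∃ b ∈ F, K ⊆ b := by
  induction h with
  | single b => exact ⟨b, rfl, hKU⟩
  | glue _ _ _ _ _ _ hadj ih₁ ih₂ =>
    rcases subset_or_subset_of_isClique hK hKU hadj with hK₁ | hK₂
    · exact (ih₁ hK₁).imp fun _ => And.imp_left .inl
    · exact (ih₂ hK₂).imp fun _ => And.imp_left .inr

/-- `G[U]` has a tree decomposition with bags of size at most `m`, one of which contains `R`. -/
def Decomposable (G : SimpleGraph V) (m : ℕ) (U R : Set V) : Prop :=
  ∃ F, IsBagTree G U F ∧ (∀ b ∈ F, b.ncard ≤ m) ∧ ∃ b ∈ F, R ⊆ b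

variable {m : ℕ}

lemma decomposable_self_of_ncard_le {U : Set V} (h : U.ncard ≤ m) : Decomposable G m U U :=
  ⟨{U}, .single U, by simpa using h, U, rfl, subset_rfl⟩

lemma Decomposable.mono {U R R' : Set V} (h : Decomposable G m U R) (hR : R' ⊆ R) :
    Decomposable G m U R' := by
  obtain ⟨F, hF, hm, b, hb, hRb⟩ := h
  exact ⟨F, hF, hm, b, hb, hR.trans hRb⟩

lemma Decomposable.of_isClique {U R K : Set V} (h : Decomposable G m U R) (hKU : K ⊆ U)
    (hK : G.IsClique K) : Decomposable G m U K := by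
  obtain ⟨F, hF, hm, -⟩ := h
  exact ⟨F, hF, hm, hF.exists_bag_of_isClique hKU hK⟩

lemma Decomposable.glue {U₁ U₂ R₁ R₂ : Set V} (h₁ : Decomposable G m U₁ R₁)
    (h₂ : Decomposable G m U₂ R₂) (hR₁ : U₁ ∩ U₂ ⊆ R₁) (hR₂ : U₁ ∩ U₂ ⊆ R₂)
    (hadj : Anticomplete G (U₁ \ U₂) (U₂ \ U₁)) : Decomposable G m (U₁ ∪ U₂) R₁ := by
  obtain ⟨F₁, hF₁, hm₁, b₁, hb₁, hRb₁⟩ := h₁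
  obtain ⟨F₂, hF₂, hm₂, b₂, hb₂, hRb₂⟩ := h₂
  exact ⟨F₁ ∪ F₂, hF₁.glue hF₂ hb₁ hb₂ (hR₁.trans hRb₁) (hR₂.trans hRb₂) hadj,
    fun b hb => hb.elim (hm₁ b) (hm₂ b), b₁, .inl hb₁, hRb₁⟩

lemma decomposable_star {ι : Type v} (t : Finset ι) {D : ι → Set V} {Ω : Set V}
    (hΩ : Ω.ncard ≤ m) (hD : Pairwise fun i j => Anticomplete G (D i) (D j))
    (hΩD : ∀ i, Disjoint Ω (D i))
    (h : ∀ i, Decomposable G m (D i ∪ Ω ∩ nbhd G (D i)) (Ω ∩ nbhd G (D i))) :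
    Decomposable G m (Ω ∪ ⋃ i ∈ t, D i) Ω := by
  classical
  induction t using Finset.induction_on with
  | empty => simpa using decomposable_self_of_ncard_le hΩ
  | insert i t hi ih =>
    have hDi : Anticomplete G (⋃ j ∈ t, D j) (D i) := by
      intro a ha b hb
      obtain ⟨j, hj, haj⟩ := Set.mem_iUnion₂.1 ha
      exact hD (ne_of_mem_of_not_mem hj hi) haj hb
    have hinter : (Ω ∪ ⋃ j ∈ t, D j) ∩ (D i ∪ Ω ∩ nbhd G (D i)) ⊆ Ω ∩ nbhd G (D i) := by
      rintro z ⟨hz, hzi | hzi⟩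
      · exact (Set.disjoint_left.1 ((hΩD i).union_left hDi.disjoint) hz hzi).elim
      · exact hzi
    have hunion : Ω ∪ ⋃ j ∈ insert i t, D j =
        (Ω ∪ ⋃ j ∈ t, D j) ∪ (D i ∪ Ω ∩ nbhd G (D i)) := by
      rw [Finset.set_biUnion_insert]
      grind
    rw [hunion]
    refine ih.glue (h i) (hinter.trans Set.inter_subset_left) hinter ?_
    rintro a ⟨ha, ha'⟩ b ⟨hb, hb'⟩
    refine ⟨fun hab => hb' (hab ▸ ha), fun hab => ?_⟩
    have hbD : b ∈ D i := hb.resolve_right fun h => hb' (.inl h.1)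
    rcases ha with haΩ | haD
    · exact ha' (.inr ⟨haΩ, b, hbD, hab.symm⟩)
    · exact (hDi haD hbD).2 hab

lemma decomposable_of_componentSet [Finite V] {U Ω : Set V} (hΩU : Ω ⊆ U) (hΩ : Ω.ncard ≤ m)
    (h : ∀ c : (G.induce (U \ Ω)).ConnectedComponent,
      Decomposable G m (componentSet c ∪ Ω ∩ nbhd G (componentSet c))
        (Ω ∩ nbhd G (componentSet c))) :
    Decomposable G m U Ω := by
  have := Fintype.ofFinite (G.induce (U \ Ω)).ConnectedComponent
  have hΩD (c : (G.induce (U \ Ω)).ConnectedComponent) : Disjoint Ω (componentSet c) :=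
    Set.disjoint_sdiff_right.mono_right (componentSet_subset c)
  have key := decomposable_star Finset.univ hΩ pairwise_anticomplete_componentSet hΩD h
  simpa [iUnion_componentSet, Set.union_sdiff_cancel hΩU] using key

end BagTrees

section Separators

variable {V : Type u} [Finite V] {G : SimpleGraph V} {s m : ℕ}

/-- Any two anticomplete connected sets have at most `s` common neighbours. Equivalently, all
minimal separators of induced subgraphs of `G` have size at most `s`. -/
def SepBounded (G : SimpleGraph V) (s : ℕ) : Prop :=
  ∀ ⦃A B : Set V⦄, (G.induce A).Connected → (G.induce B).Connected → Anticomplete G A B →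
    (nbhd G A ∩ nbhd G B).ncard ≤ s

/-- For every connected set `A` outside `U`, possibly empty, that has at most `s` neighbours in `U`,
there is a tree decomposition of `G[U]` with bags of size at most `m`, one of which contains all
these neighbours. This is the induction hypothesis on `U` in the construction of decompositions. -/
def RootedDecomposable (G : SimpleGraph V) (s m : ℕ) (U : Set V) : Prop :=
  ∀ ⦃A : Set V⦄, (G.induce A).Preconnected → Disjoint A U → (U ∩ nbhd G A).ncard ≤ s →
    Decomposable G m U (U ∩ nbhd G A)

lemma SepBounded.decomposable_union_inter_nbhd (hs : SepBounded G s) {U Ω A D : Set V}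
    (ih : ∀ U' ⊂ U, RootedDecomposable G s m U') (hA : (G.induce A).Connected)
    (hD : (G.induce D).Connected) (hAD : Anticomplete G A D) (hAU : (A ∩ U).Nonempty)
    (hDU : D ⊆ U) (hΩU : Ω ⊆ U) (hΩA : Ω ⊆ nbhd G A) :
    Decomposable G m (D ∪ Ω ∩ nbhd G D) (Ω ∩ nbhd G D) := by
  have hdis : Disjoint A (D ∪ Ω ∩ nbhd G D) :=
    hAD.disjoint.union_right (hAD.disjoint_nbhd.mono_right Set.inter_subset_right)
  have hss : D ∪ Ω ∩ nbhd G D ⊂ U := by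
    obtain ⟨p, hpA, hpU⟩ := hAU
    exact ⟨Set.union_subset hDU (Set.inter_subset_left.trans hΩU),
      fun h => Set.disjoint_left.1 hdis hpA (h hpU)⟩
  have hroot : (D ∪ Ω ∩ nbhd G D) ∩ nbhd G A = Ω ∩ nbhd G D := by
    rw [Set.union_inter_distrib_right, hAD.symm.disjoint_nbhd.inter_eq, Set.empty_union]
    exact Set.inter_eq_left.2 (Set.inter_subset_left.trans hΩA)
  have hcard : (Ω ∩ nbhd G D).ncard ≤ s :=
    (Set.ncard_le_ncard (Set.inter_subset_inter_left _ hΩA)).trans (hs hA hD hAD)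
  have key := ih _ hss hA.preconnected hdis
  rw [hroot] at key
  exact key hcard

lemma SepBounded.decomposable_of_not_adj (hs : SepBounded G s) (hm : 2 * s ≤ m) {U A : Set V}
    (ih : ∀ U' ⊂ U, RootedDecomposable G s m U') (hAU : Disjoint A U)
    (hcard : (U ∩ nbhd G A).ncard ≤ s) {x y : V} (hx : x ∈ U) (hy : y ∈ U) (hxy : x ≠ y)
    (hadj : ¬ G.Adj x y) (hxA : (G.induce (A ∪ {x})).Connected)
    (hyA : (G.induce (A ∪ {y})).Connected) : Decomposable G m U (U ∩ nbhd G A) := by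
  obtain ⟨Y, hyY, hY, hxY, hUY⟩ := exists_connected_anticomplete_singleton hy hxy hadj
  have hAY : (G.induce (A ∪ Y)).Connected := by
    have := induce_union_connected hyA.preconnected hY.preconnected ⟨y, .inr rfl, hyY⟩
    rwa [Set.union_assoc, Set.singleton_union, Set.insert_eq_of_mem hyY] at this
  let T : Set V := U ∩ (nbhd G {x} ∩ nbhd G Y)
  have hTcard : T.ncard ≤ s := (Set.ncard_le_ncard Set.inter_subset_right).trans
    (hs (connected_induce_singleton x) hY hxY)
  let Ω : Set V := U ∩ nbhd G A ∪ T
  have hΩU : Ω ⊆ U := Set.union_subset Set.inter_subset_left Set.inter_subset_left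
  have hΩcard : Ω.ncard ≤ m := (Set.ncard_union_le _ _).trans (by omega)
  have hΩA {P : Set V} (hTP : T ⊆ nbhd G P) : Ω ⊆ nbhd G (A ∪ P) := by
    rw [nbhd_union]
    exact Set.union_subset_union Set.inter_subset_right hTP
  refine (decomposable_of_componentSet hΩU hΩcard fun c => ?_).mono Set.subset_union_left
  have hD := connected_induce_componentSet c
  have hDU := componentSet_subset c
  generalize componentSet c = D at hD hDU ⊢
  have hAD : Anticomplete G A D :=
    anticomplete_of_disjoint (hAU.mono_right fun d hd => (hDU hd).1)
      (Set.disjoint_left.2 fun d hd hdA => (hDU hd).2 (.inl ⟨(hDU hd).1, hdA⟩))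
  have hDY : D ∩ nbhd G Y ⊆ Y := fun d ⟨hd, hdY⟩ =>
    (hUY ⟨(hDU hd).1, hdY⟩).resolve_right
      fun hdx => (hDU hd).2 (.inr ⟨(hDU hd).1, hdx, hdY⟩)
  rcases anticomplete_or_anticomplete hD.preconnected hxY hDY with hxD | hYD
  · exact hs.decomposable_union_inter_nbhd ih hxA hD (hAD.union_left hxD) ⟨x, .inr rfl, hx⟩
      (hDU.trans Set.sdiff_subset) hΩU (hΩA fun z hz => hz.2.1)
  · exact hs.decomposable_union_inter_nbhd ih hAY hD (hAD.union_left hYD) ⟨y, .inr hyY, hy⟩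
      (hDU.trans Set.sdiff_subset) hΩU (hΩA fun z hz => hz.2.2)

lemma SepBounded.rootedDecomposable (hs : SepBounded G s) (hm : 2 * s ≤ m)
    (hclique : ∀ K : Set V, G.IsClique K → K.ncard ≤ m) (U : Set V) :
    RootedDecomposable G s m U := by
  induction U using WellFoundedLT.induction with | ind U ih =>
  intro A hA hAU hcard
  by_cases hR : G.IsClique (U ∩ nbhd G A)
  · by_cases hU : G.IsClique U
    · exact (decomposable_self_of_ncard_le (hclique U hU)).mono Set.inter_subset_left
    obtain ⟨x, hx, y, hy, hxy, hadj⟩ := exists_not_adj_of_not_isClique hU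
    have hempty : (U ∩ nbhd G ∅).ncard ≤ s := by simp [nbhd]
    have hconn (z : V) : (G.induce (∅ ∪ {z})).Connected := by
      rw [Set.empty_union]
      exact connected_induce_singleton z
    have hdec : Decomposable G m U (U ∩ nbhd G ∅) :=
      hs.decomposable_of_not_adj hm ih (Set.empty_disjoint U) hempty hx hy hxy hadj (hconn x)
        (hconn y)
    exact hdec.of_isClique Set.inter_subset_left hR
  · obtain ⟨x, ⟨hx, a, ha, hax⟩, y, ⟨hy, b, hb, hby⟩, hxy, hadj⟩ :=
      exists_not_adj_of_not_isClique hR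
    exact hs.decomposable_of_not_adj hm ih hAU hcard hx hy hxy hadj
      (connected_induce_union hA (connected_induce_singleton x).preconnected ha rfl hax)
      (connected_induce_union hA (connected_induce_singleton y).preconnected hb rfl hby)

end Separators

section Trees

lemma isTree_sum_sup_edge {N₁ : Type u} {N₂ : Type v} [Finite N₁] [Finite N₂]
    {T₁ : SimpleGraph N₁} {T₂ : SimpleGraph N₂} (h₁ : T₁.IsTree) (h₂ : T₂.IsTree)
    (t₁ : N₁) (t₂ : N₂) : ((T₁ ⊕g T₂) ⊔ edge (.inl t₁) (.inr t₂)).IsTree := by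
  classical
  have := Fintype.ofFinite N₁
  have := Fintype.ofFinite N₂
  have e₁ := (isTree_iff_connected_and_card.1 h₁).2
  have e₂ := (isTree_iff_connected_and_card.1 h₂).2
  refine isTree_iff_connected_and_card.2 ⟨h₁.connected.sum_sup_edge h₂.connected, ?_⟩
  rw [Nat.card_eq_fintype_card, ← edgeFinset_card, card_edgeFinset_sup_edge _ (by simp) (by simp),
    edgeFinset_card, ← Nat.card_eq_fintype_card, Nat.card_congr edgeSetSumEquiv, Nat.card_sum,
    Nat.card_sum]
  omega

lemma connected_induce_sum_sup_edge {N₁ : Type u} {N₂ : Type v} {T₁ : SimpleGraph N₁}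
    {T₂ : SimpleGraph N₂} {S₁ : Set N₁} {S₂ : Set N₂} {t₁ : N₁} {t₂ : N₂}
    (h₁ : S₁.Nonempty → (T₁.induce S₁).Connected) (h₂ : S₂.Nonempty → (T₂.induce S₂).Connected)
    (hne : S₁.Nonempty ∨ S₂.Nonempty)
    (ht : S₁.Nonempty → S₂.Nonempty → t₁ ∈ S₁ ∧ t₂ ∈ S₂) :
    (((T₁ ⊕g T₂) ⊔ edge (.inl t₁) (.inr t₂)).induce (.inl '' S₁ ∪ .inr '' S₂)).Connected := by
  let f₁ : T₁ →g (T₁ ⊕g T₂) ⊔ edge (.inl t₁) (.inr t₂) :=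
    (Hom.ofLE le_sup_left).comp Embedding.sumInl.toHom
  let f₂ : T₂ →g (T₁ ⊕g T₂) ⊔ edge (.inl t₁) (.inr t₂) :=
    (Hom.ofLE le_sup_left).comp Embedding.sumInr.toHom
  rcases S₁.eq_empty_or_nonempty with rfl | hS₁
  · rw [Set.image_empty, Set.empty_union]
    exact connected_induce_image f₂ (h₂ (hne.resolve_left Set.not_nonempty_empty))
  rcases S₂.eq_empty_or_nonempty with rfl | hS₂
  · rw [Set.image_empty, Set.union_empty]
    exact connected_induce_image f₁ (h₁ hS₁)
  obtain ⟨ht₁, ht₂⟩ := ht hS₁ hS₂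
  exact connected_induce_union (connected_induce_image f₁ (h₁ hS₁)).preconnected
    (connected_induce_image f₂ (h₂ hS₂)).preconnected ⟨t₁, ht₁, rfl⟩ ⟨t₂, ht₂, rfl⟩ (by simp [edge])

lemma IsBagTree.exists_tree {V : Type u} {G : SimpleGraph V} {U : Set V} {F : Set (Set V)}
    (h : IsBagTree G U F) :
    ∃ (N : Type) (_ : Finite N) (T : SimpleGraph N) (bag : N → Set V), T.IsTree ∧
      Set.range bag = F ∧ ∀ a ∈ U, (T.induce {t | a ∈ bag t}).Connected := by
  induction h with
  | single b =>
    refine ⟨Unit, inferInstance, ⊥, fun _ => b, .of_subsingleton, Set.range_const, fun a ha => ?_⟩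
    have : Nonempty {_t : Unit | a ∈ b} := ⟨⟨(), ha⟩⟩
    exact .of_subsingleton
  | @glue U₁ U₂ _ _ _ _ h₁ h₂ hb₁ hb₂ hsub₁ hsub₂ _ ih₁ ih₂ =>
    obtain ⟨N₁, _, T₁, bag₁, hT₁, rfl, hconn₁⟩ := ih₁
    obtain ⟨N₂, _, T₂, bag₂, hT₂, rfl, hconn₂⟩ := ih₂
    obtain ⟨t₁, rfl⟩ := hb₁
    obtain ⟨t₂, rfl⟩ := hb₂
    refine ⟨N₁ ⊕ N₂, inferInstance, (T₁ ⊕g T₂) ⊔ edge (.inl t₁) (.inr t₂), Sum.elim bag₁ bag₂,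
      isTree_sum_sup_edge hT₁ hT₂ t₁ t₂, Set.Sum.elim_range _ _, fun a ha => ?_⟩
    have hnodes : {t | a ∈ Sum.elim bag₁ bag₂ t} =
        .inl '' {t | a ∈ bag₁ t} ∪ .inr '' {t | a ∈ bag₂ t} := by
      ext (t | t) <;> simp
    have hU₁ : {t | a ∈ bag₁ t}.Nonempty → a ∈ U₁ := fun ⟨t, ht⟩ => h₁.subset ⟨t, rfl⟩ ht
    have hU₂ : {t | a ∈ bag₂ t}.Nonempty → a ∈ U₂ := fun ⟨t, ht⟩ => h₂.subset ⟨t, rfl⟩ ht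
    rw [hnodes]
    refine connected_induce_sum_sup_edge (fun h => hconn₁ a (hU₁ h)) (fun h => hconn₂ a (hU₂ h))
      (ha.imp (fun h => Set.nonempty_coe_sort.1 (hconn₁ a h).nonempty)
        fun h => Set.nonempty_coe_sort.1 (hconn₂ a h).nonempty)
      fun hne₁ hne₂ => ?_
    have haU : a ∈ U₁ ∩ U₂ := ⟨hU₁ hne₁, hU₂ hne₂⟩
    exact ⟨hsub₁ haU, hsub₂ haU⟩

lemma Decomposable.treewidth_le {V : Type u} {G : SimpleGraph V} {m : ℕ} {R : Set V}
    (h : Decomposable G m Set.univ R) : treewidth G ≤ m - 1 := by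
  obtain ⟨F, hF, hm, -⟩ := h
  obtain ⟨N, hN, T, bag, hT, rfl, hconn⟩ := hF.exists_tree
  have := hT.connected.nonempty
  let D : TreeDecomposition G :=
    { Node := N
      finite_node := hN
      tree := T
      isTree := hT
      bag := bag
      iUnion_bag := Set.eq_univ_of_forall fun a =>
        let ⟨⟨t, ht⟩⟩ := (hconn a trivial).nonempty
        Set.mem_iUnion.2 ⟨t, ht⟩
      exists_bag_of_adj := fun a b hab => by
        obtain ⟨_, ⟨t, rfl⟩, ht⟩ :=
          hF.exists_bag_of_isClique (Set.subset_univ {a, b}) (isClique_pair.2 fun _ => hab)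
        exact ⟨t, ht (.inl rfl), ht (.inr rfl)⟩
      connected_nodes := fun a => hconn a trivial }
  have hD : D.width ≤ m - 1 := Nat.sub_le_sub_right (ciSup_le fun t => hm _ ⟨t, rfl⟩) 1
  have htw : treewidth G ≤ D.width := Nat.sInf_le ⟨D, rfl⟩
  exact htw.trans hD

end Trees

section Ramsey

variable {V : Type u}

lemma exists_isNClique_or_isNIndepSet_of_choose_le_card (G : SimpleGraph V) {k l : ℕ}
    {S : Finset V} (hS : (k + l).choose k ≤ S.card) :
    (∃ t ⊆ S, G.IsNClique k t) ∨ ∃ t ⊆ S, G.IsNIndepSet l t := by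
  classical
  induction k generalizing l S with
  | zero => exact .inl ⟨∅, S.empty_subset, isNClique_empty.2 rfl⟩
  | succ k ihk =>
  induction l generalizing S with
  | zero => exact .inr ⟨∅, S.empty_subset, (isNClique_compl G).1 (isNClique_empty.2 rfl)⟩
  | succ l ihl =>
  obtain ⟨v, hv⟩ : S.Nonempty :=
    Finset.card_pos.1 ((Nat.choose_pos (Nat.le_add_right _ _)).trans_le hS)
  let A := {w ∈ S.erase v | G.Adj v w}
  let B := {w ∈ S.erase v | ¬ G.Adj v w}
  have hAS : A ⊆ S := (Finset.filter_subset _ _).trans (Finset.erase_subset _ _)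
  have hBS : B ⊆ S := (Finset.filter_subset _ _).trans (Finset.erase_subset _ _)
  have hcard : A.card + B.card + 1 = S.card := by
    rw [Finset.card_filter_add_card_filter_not, Finset.card_erase_add_one hv]
  have hpascal : (k + 1 + (l + 1)).choose (k + 1) =
      (k + (l + 1)).choose k + (k + 1 + l).choose (k + 1) := by
    rw [show k + 1 + (l + 1) = k + (l + 1) + 1 by ring, Nat.choose_succ_succ',
      show k + 1 + l = k + (l + 1) by ring]
  rcases le_or_gt ((k + (l + 1)).choose k) A.card with hA | hA
  · rcases ihk hA with ⟨t, htA, ht⟩ | ⟨t, htA, ht⟩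
    · exact .inl ⟨insert v t, Finset.insert_subset hv (htA.trans hAS),
        ht.insert fun b hb => (Finset.mem_filter.1 (htA hb)).2⟩
    · exact .inr ⟨t, htA.trans hAS, ht⟩
  · rcases ihl (show (k + 1 + l).choose (k + 1) ≤ B.card by omega) with ⟨t, htB, ht⟩ | ⟨t, htB, ht⟩
    · exact .inl ⟨t, htB.trans hBS, ht⟩
    · refine .inr ⟨insert v t, Finset.insert_subset hv (htB.trans hBS), ?_⟩
      refine (isNClique_compl G).1 (((isNClique_compl G).2 ht).insert fun b hb => ?_)
      obtain ⟨hbv, hvb⟩ := Finset.mem_filter.1 (htB hb)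
      exact (compl_adj G v b).2 ⟨(Finset.ne_of_mem_erase hbv).symm, hvb⟩

lemma exists_isNClique_or_isNIndepSet_of_ramseyNumber_le {k l n : ℕ} (hn : ramseyNumber k l ≤ n)
    (G : SimpleGraph (Fin n)) :
    (∃ t, G.IsNClique k t) ∨ ∃ t, G.IsNIndepSet l t := by
  refine (Nat.sInf_mem (s := {N | 0 < N ∧ ∀ n, N ≤ n → ∀ G : SimpleGraph (Fin n),
    (∃ t, G.IsNClique k t) ∨ ∃ t, G.IsNIndepSet l t}) ?_).2 n hn G
  refine ⟨(k + l).choose k, Nat.choose_pos (Nat.le_add_right k l), fun n hn G => ?_⟩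
  exact (exists_isNClique_or_isNIndepSet_of_choose_le_card G (S := .univ) (by simpa using hn)).imp
    (fun ⟨t, _, ht⟩ => ⟨t, ht⟩) fun ⟨t, _, ht⟩ => ⟨t, ht⟩

lemma exists_isNClique_or_isNIndepSet_of_ramseyNumber_le_ncard (G : SimpleGraph V) {k l : ℕ}
    {S : Set V} (hS : ramseyNumber k l ≤ S.ncard) (hfin : S.Finite) :
    (∃ t : Finset V, ↑t ⊆ S ∧ G.IsNClique k t) ∨ ∃ t : Finset V, ↑t ⊆ S ∧ G.IsNIndepSet l t := by
  have := hfin.to_subtype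
  let e : Fin S.ncard ≃ S := (Finite.equivFinOfCardEq rfl).symm
  let f : Fin S.ncard ↪ V := e.toEmbedding.trans (.subtype _)
  have hf (t : Finset (Fin S.ncard)) : ↑(t.map f) ⊆ S := by
    rw [Finset.coe_map]
    exact (Set.image_subset_range f t).trans (Set.range_subset_iff.2 fun i => (e i).2)
  rcases exists_isNClique_or_isNIndepSet_of_ramseyNumber_le hS (G.comap f) with
    ⟨t, ht⟩ | ⟨t, ht⟩
  · exact .inl ⟨t.map f, hf t, ht.map.mono (map_comap_le f G)⟩
  · refine .inr ⟨t.map f, hf t, ?_, by rw [Finset.card_map, ht.card_eq]⟩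
    rw [Finset.coe_map]
    exact f.injective.injOn.pairwise_image.2 ht.isIndepSet

end Ramsey

section InducedMinors

variable {V : Type u} {V' : Type v} {W : Type w} {G : SimpleGraph V} {G' : SimpleGraph V'}

lemma IsInducedMinor.map {H : SimpleGraph W} (h : IsInducedMinor H G) (f : G ↪g G') :
    IsInducedMinor H G' := by
  obtain ⟨M⟩ := h
  exact ⟨{
    bag := fun a => f '' M.bag a
    disjoint_bag := fun a b hab => (Set.disjoint_image_iff f.injective).2 (M.disjoint_bag a b hab)
    connected_bag := fun a => connected_induce_image f.toHom (M.connected_bag a)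
    adj_iff := fun a b hab => by
      simpa only [Set.exists_mem_image, f.map_adj_iff] using M.adj_iff a b hab }⟩

lemma isInducedMinor_completeBipartiteGraph {α : Type v} {β : Type w} {A : α → Set V}
    {B : β → Set V} (hA : ∀ i, (G.induce (A i)).Connected) (hB : ∀ j, (G.induce (B j)).Connected)
    (hAA : Pairwise fun i i' => Anticomplete G (A i) (A i'))
    (hBB : Pairwise fun j j' => Anticomplete G (B j) (B j'))
    (hdis : ∀ i j, Disjoint (A i) (B j)) (hAB : ∀ i j, ∃ a ∈ A i, ∃ b ∈ B j, G.Adj a b) :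
    IsInducedMinor (completeBipartiteGraph α β) G := by
  refine ⟨⟨Sum.elim A B, ?_, Sum.forall.2 ⟨hA, hB⟩, ?_⟩⟩
  · rintro (i | j) (i' | j') hne
    · exact (hAA fun h => hne (congrArg _ h)).disjoint
    · exact hdis i j'
    · exact (hdis i' j).symm
    · exact (hBB fun h => hne (congrArg _ h)).disjoint
  · rintro (i | j) (i' | j') hne
    · have hac := hAA fun h => hne (congrArg _ h)
      exact iff_of_false (fun ⟨_, ha, _, hb, hab⟩ => (hac ha hb).2 hab) (by simp)
    · exact iff_of_true (hAB i j') (by simp)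
    · obtain ⟨a, ha, b, hb, hab⟩ := hAB i' j
      exact iff_of_true ⟨b, hb, a, ha, hab.symm⟩ (by simp)
    · have hac := hBB fun h => hne (congrArg _ h)
      exact iff_of_false (fun ⟨_, ha, _, hb, hab⟩ => (hac ha hb).2 hab) (by simp)

lemma isInducedMinor_completeBipartiteGraph_of_isNIndepSet {A B : Set V}
    (hA : (G.induce A).Connected) (hB : (G.induce B).Connected) (hAB : Anticomplete G A B) {q : ℕ}
    {t : Finset V} (ht : G.IsNIndepSet q t) (htA : ↑t ⊆ nbhd G A) (htB : ↑t ⊆ nbhd G B) :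
    IsInducedMinor (completeBipartiteGraph (Fin 2) (Fin q)) G := by
  let e : Fin q ≃ t := (t.equivFinOfCardEq ht.card_eq).symm
  refine isInducedMinor_completeBipartiteGraph (A := ![A, B]) (B := fun j => {(e j : V)})
    (Fin.forall_fin_two.2 ⟨hA, hB⟩) (fun _ => connected_induce_singleton _) ?_ ?_ ?_ ?_
  · intro i i' hne
    fin_cases i <;> fin_cases i'
    exacts [(hne rfl).elim, hAB, hAB.symm, (hne rfl).elim]
  · rintro j j' hne _ rfl _ rfl
    have hne' : (e j : V) ≠ e j' := fun h => hne (e.injective (Subtype.ext h))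
    exact ⟨hne', ht.isIndepSet (e j).2 (e j').2 hne'⟩
  · simp only [Set.disjoint_singleton_right]
    exact Fin.forall_fin_two.2
      ⟨fun j => hAB.disjoint_nbhd.notMem_of_mem_right (htB (e j).2),
        fun j => hAB.symm.disjoint_nbhd.notMem_of_mem_right (htA (e j).2)⟩
  · have hadj {P : Set V} (hP : ↑t ⊆ nbhd G P) (j : Fin q) :
        ∃ a ∈ P, ∃ b ∈ ({(e j : V)} : Set V), G.Adj a b := by
      obtain ⟨a, ha, hadj⟩ := hP (e j).2
      exact ⟨a, ha, _, rfl, hadj⟩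
    exact Fin.forall_fin_two.2 ⟨hadj htA, hadj htB⟩

end InducedMinors

section Treewidth

variable {V : Type u} [Finite V] {G : SimpleGraph V}

lemma sepBounded_of_not_isInducedMinor {q : ℕ}
    (hG : ¬ IsInducedMinor (completeBipartiteGraph (Fin 2) (Fin q)) G) :
    SepBounded G (ramseyNumber (G.cliqueNum + 1) q - 1) := by
  intro A B hA hB hAB
  by_contra! hlt
  rcases exists_isNClique_or_isNIndepSet_of_ramseyNumber_le_ncard G (Nat.le_of_pred_lt hlt)
    (Set.toFinite _) with ⟨t, -, ht⟩ | ⟨t, htS, ht⟩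
  · have hle := ht.isClique.card_le_cliqueNum
    rw [ht.card_eq] at hle
    omega
  · exact hG (isInducedMinor_completeBipartiteGraph_of_isNIndepSet hA hB hAB ht
      (htS.trans Set.inter_subset_left) (htS.trans Set.inter_subset_right))

lemma SepBounded.treewidth_le {s : ℕ} (hs : SepBounded G s) :
    treewidth G ≤ max G.cliqueNum (2 * s) - 1 := by
  have hclique (K : Set V) (hK : G.IsClique K) : K.ncard ≤ max G.cliqueNum (2 * s) := by
    have hK' : G.IsClique (K.toFinite.toFinset : Set V) := by rwa [Set.Finite.coe_toFinset]
    rw [Set.ncard_eq_toFinset_card K]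
    exact le_max_of_le_left hK'.card_le_cliqueNum
  have hempty : (Set.univ ∩ nbhd G ∅).ncard ≤ s := by simp [nbhd]
  exact (hs.rootedDecomposable (le_max_right _ _) hclique Set.univ .of_subsingleton
    (Set.empty_disjoint _) hempty).treewidth_le

lemma isTwOmegaBindingFunction_inducedMinorFree (q : ℕ) :
    IsTwOmegaBindingFunction.{u} (inducedMinorFree (completeBipartiteGraph (Fin 2) (Fin q)))
      (fun k => max k (2 * ramseyNumber (k + 1) q - 2) - 1) := by
  intro V _ G hG S
  have hs := sepBounded_of_not_isInducedMinor fun h => hG (h.map (Embedding.induce S))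
  exact hs.treewidth_le.trans_eq (by rw [Nat.mul_sub])

end Treewidth

end TwOmega

theorem mainTheorem7 (q : ℕ) :
    TwOmega.IsTwOmegaBounded.{u}
        (TwOmega.inducedMinorFree (completeBipartiteGraph (Fin 2) (Fin q))) ∧
      TwOmega.IsTwOmegaBindingFunction.{u}
        (TwOmega.inducedMinorFree (completeBipartiteGraph (Fin 2) (Fin q)))
        (fun k => max k (2 * TwOmega.ramseyNumber (k + 1) q - 2) - 1) :=
  have h := TwOmega.isTwOmegaBindingFunction_inducedMinorFree q
  ⟨⟨_, h⟩, h⟩
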